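/- Let $p>1$ be an integer and let $A\in M_n(\mathbb R)$ be nonsingular, with $r_1$ distinct positive real eigenvalues, $r_2$ distinct negative real eigenvalues and $c$ distinct complex-conjugate pairs of nonreal eigenvalues. For $z=re^{\mathrm i\theta}\neq 0$ with $r>0$ and $\theta\in(-\pi,\pi]$, and for $j\in\{0,\dots,p-1\}$, $k\ge 0$, put $$f_j^{(k)}(z)=\frac1{p^k}\prod_{i=0}^{k-1}(1-ip)\; r^{(1-kp)/p}\,e^{\mathrm i[2\pi j+\theta(1-kp)]/p},$$ so that $f_j=f_j^{(0)}$ are the branches of the $p$th-root function. For the $m\times m$ Jordan block $J_m(\lambda)$, $\lambda\ne0$, let $f_j(J_m(\lambda))$ be the upper triangular matrix whose $(a,b)$ entry is $f_j^{(b-a)}(\lambda)/(b-a)!$ for $a\le b$ and $0$ otherwise. A primary $p$th-root of $A$ is a complex matrix $X$ with $X^p=A$ of the form $X=Z\bigl(\bigoplus_{i=1}^t f_{j_i}(J_{n_i}(\lambda_i))\bigr)Z^{-1}$, where $A=Z\bigl(\bigoplus_{i=1}^t J_{n_i}(\lambda_i)\bigr)Z^{-1}$ is a Jordan decomposition of $A$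 over $\mathbb C$, $j_i\in\{0,\dots,p-1\}$, and $j_i=j_k$ whenever $\lambda_i=\lambda_k$. If $p$ is even, then $A$ has exactly $2^{r_1}p^c$ real primary $p$th-roots when $r_2=0$, and no real primary $p$th-root when $r_2>0$. If $p$ is odd, then $A$ has exactly $p^c$ real primary $p$th-roots. -/

import Mathlib

/-- The branch `f_j` of the `p`-th root function: for `z = r exp (i θ)` with `r = ‖z‖ > 0` and
`θ = arg z ∈ (-π, π]`, `f_j z = r ^ (1/p) * exp (i (θ + 2 π j) / p)`. -/
noncomputable def rootBranch (p j : ℕ) (z : ℂ) : ℂ :=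
  ((‖z‖ ^ ((1 : ℝ) / p) : ℝ) : ℂ) *
    Complex.exp (Complex.I * ((Complex.arg z : ℂ) + 2 * (Real.pi : ℂ) * j) / p)

/-- The `k`-th derivative of the branch `f_j` of the `p`-th root function at
`z = r exp (i θ) ≠ 0`, `θ = arg z`, i.e.
`p⁻ᵏ ∏_{i < k} (1 - i p) * r ^ ((1 - k p) / p) * exp (i (2 π j + θ (1 - k p)) / p)`.
It is given by its closed form, as `arg` jumps across the negative real axis; for negative real `z`
(`θ = π`) it is the derivative of the branch continued analytically across that axis.
Off the axis it is the usual derivative, see `hasDerivAt_rootBranchDeriv`. -/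
noncomputable def rootBranchDeriv (p j k : ℕ) (z : ℂ) : ℂ :=
  1 / (p : ℂ) ^ k * (∏ i ∈ Finset.range k, (1 - (i : ℂ) * p)) *
    (((‖z‖ ^ ((1 - (k : ℝ) * p) / p) : ℝ) : ℂ) *
      Complex.exp (Complex.I *
        (2 * (Real.pi : ℂ) * j + (Complex.arg z : ℂ) * (1 - (k : ℂ) * p)) / p))

theorem rootBranchDeriv_zero (p j : ℕ) (z : ℂ) :
    rootBranchDeriv p j 0 z = rootBranch p j z := by
  simp [rootBranchDeriv, rootBranch, add_comm]

theorem rootBranchDeriv_eq_cpow {p : ℕ} (hp : 0 < p) (j k : ℕ) {z : ℂ} (hz : z ≠ 0) :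
    rootBranchDeriv p j k z =
      1 / (p : ℂ) ^ k * (∏ i ∈ Finset.range k, (1 - (i : ℂ) * p)) *
        (Complex.exp (2 * Real.pi * j * Complex.I / p) * z ^ ((1 - (k : ℂ) * p) / p)) := by
  have hr : 0 < ‖z‖ := norm_pos_iff.mpr hz
  have hp' : (p : ℂ) ≠ 0 := by exact_mod_cast hp.ne'
  unfold rootBranchDeriv
  congr 1
  rw [Complex.cpow_def_of_ne_zero hz, Real.rpow_def_of_pos hr, Complex.ofReal_exp,
    ← Complex.exp_add, ← Complex.exp_add, Complex.log]
  congr 1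
  push_cast
  ring

/-- Sanity check: off the branch cut, consecutive `rootBranchDeriv`s are derivatives. -/
theorem hasDerivAt_rootBranchDeriv {p : ℕ} (hp : 0 < p) (j k : ℕ) {z : ℂ}
    (hz : z ∈ Complex.slitPlane) :
    HasDerivAt (rootBranchDeriv p j k) (rootBranchDeriv p j (k + 1) z) z := by
  have hp' : (p : ℂ) ≠ 0 := by exact_mod_cast hp.ne'
  have hz0 := Complex.slitPlane_ne_zero hz
  have h1 := ((hasDerivAt_id z).cpow_const (c := (1 - (k : ℂ) * p) / p) hz).const_mul
    (Complex.exp (2 * Real.pi * j * Complex.I / p))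
  have h2 := h1.const_mul (1 / (p : ℂ) ^ k * (∏ i ∈ Finset.range k, (1 - (i : ℂ) * p)))
  have h3 : rootBranchDeriv p j k =ᶠ[nhds z] fun w =>
      1 / (p : ℂ) ^ k * (∏ i ∈ Finset.range k, (1 - (i : ℂ) * p)) *
        (Complex.exp (2 * Real.pi * j * Complex.I / p) * w ^ ((1 - (k : ℂ) * p) / p)) := by
    filter_upwards [isOpen_ne.mem_nhds hz0] with w hw
    exact rootBranchDeriv_eq_cpow hp j k hw
  refine HasDerivAt.congr_of_eventuallyEq ?_ h3
  refine h2.congr_deriv ?_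
  rw [rootBranchDeriv_eq_cpow hp j (k + 1) hz0, Finset.prod_range_succ, pow_succ]
  have : (1 - ((k + 1 : ℕ) : ℂ) * p) / p = (1 - (k : ℂ) * p) / p - 1 := by
    push_cast; field_simp; ring
  rw [this]
  simp only [id]
  generalize ∏ i ∈ Finset.range k, (1 - (i : ℂ) * p) = P
  generalize z ^ ((1 - (k : ℂ) * p) / p - 1) = w
  field_simp

/-- The `m × m` Jordan block with eigenvalue `μ`. -/
def jordanBlock (m : ℕ) (μ : ℂ) : Matrix (Fin m) (Fin m) ℂ :=
  Matrix.of fun a b => if a = b then μ else if (a : ℕ) + 1 = b then 1 else 0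

/-- The matrix function `f_j (J_m(μ))`: the upper triangular Toeplitz matrix with entries
`f_j^{(b - a)}(μ) / (b - a)!` for `a ≤ b`. -/
noncomputable def rootBranchJordanBlock (p j m : ℕ) (μ : ℂ) : Matrix (Fin m) (Fin m) ℂ :=
  Matrix.of fun a b =>
    if a ≤ b then rootBranchDeriv p j ((b : ℕ) - a) μ / (((b : ℕ) - a).factorial : ℂ) else 0

/-- A Jordan decomposition `A = Z (⨁ i, J_{n_i}(μ_i)) Z⁻¹` of a complex `n × n` matrix.
The bijection `e` places the rows of the blocks in `Fin n` (a different
placement amounts to a permutation of the columns of `Z`). -/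
structure JordanDecomposition {n : ℕ} (A : Matrix (Fin n) (Fin n) ℂ) where
  /-- number of Jordan blocks -/
  t : ℕ
  /-- sizes of the blocks -/
  size : Fin t → ℕ
  size_pos : ∀ i, 0 < size i
  /-- eigenvalues of the blocks -/
  eig : Fin t → ℂ
  e : (Σ i, Fin (size i)) ≃ Fin n
  Z : Matrix (Fin n) (Fin n) ℂ
  isUnit_det : IsUnit Z.det
  eq : A = Z * Matrix.reindex e e
    (Matrix.blockDiagonal' fun i => jordanBlock (size i) (eig i)) * Z⁻¹

/-- `X` is a primary `p`-th root of the (nonsingular) matrix `A`: a `p`-th root of the form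
`Z (⨁ i, f_{j_i} (J_{n_i}(μ_i))) Z⁻¹` for a Jordan decomposition
`A = Z (⨁ i, J_{n_i}(μ_i)) Z⁻¹`, where blocks with the same eigenvalue use the same branch. -/
def IsPrimaryRoot {n : ℕ} (p : ℕ) (A X : Matrix (Fin n) (Fin n) ℂ) : Prop :=
  X ^ p = A ∧ ∃ (D : JordanDecomposition A) (j : Fin D.t → Fin p),
    (∀ i k, D.eig i = D.eig k → j i = j k) ∧
    X = D.Z * Matrix.reindex D.e D.e
      (Matrix.blockDiagonal' fun i => rootBranchJordanBlock p (j i) (D.size i) (D.eig i)) * D.Z⁻¹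

/-- The set of real primary `p`-th roots of a real matrix. -/
def realPrimaryRoots {n : ℕ} (p : ℕ) (A : Matrix (Fin n) (Fin n) ℝ) :
    Set (Matrix (Fin n) (Fin n) ℝ) :=
  {X | IsPrimaryRoot p (A.map Complex.ofReal) (X.map Complex.ofReal)}

/-- The number of distinct positive real eigenvalues. -/
noncomputable def numPosEig {n : ℕ} (A : Matrix (Fin n) (Fin n) ℝ) : ℕ :=
  {x : ℝ | x ∈ spectrum ℝ A ∧ 0 < x}.ncard

/-- The number of distinct negative real eigenvalues. -/
noncomputable def numNegEig {n : ℕ} (A : Matrix (Fin n) (Fin n) ℝ) : ℕ :=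
  {x : ℝ | x ∈ spectrum ℝ A ∧ x < 0}.ncard

/-- The number of distinct complex-conjugate pairs of nonreal eigenvalues; each pair is counted
through its member with positive imaginary part. -/
noncomputable def numConjPairs {n : ℕ} (A : Matrix (Fin n) (Fin n) ℝ) : ℕ :=
  {z : ℂ | z ∈ spectrum ℂ (A.map Complex.ofReal) ∧ 0 < z.im}.ncard

/-!
Let `B` be the complexification of `A`. The primary `p`-th roots of the nonsingular matrix `B` are
exactly its `p`-th roots of the form `q(B)` with `q` a complex polynomial (`isPrimaryRoot_iff`), and
such a root is determined by the values of `q` at the eigenvalues of `B` (`aeval_eq_of_eval_eq`),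
which may be prescribed as arbitrary `p`-th roots of the eigenvalues (`exists_aeval_pow_eq`, by
Lagrange interpolation followed by Newton's method modulo the characteristic polynomial).

The comparison with the definition through Jordan blocks takes place in the ring of power series:
the upper triangular Toeplitz matrices are the image of `ℂ⟦X⟧` under the homomorphism `toeplitz`,
the block `J_m(μ)` is the image of `μ + X`, and `f_j(J_m(μ))` is the image of the Taylor series of
`f_j` at `μ`. That series is a rescaled binomial series with exponent `1 / p`, so its `p`-th power
is `μ + X` (`rootBranchSeries_pow`), and two Toeplitz `p`-th roots of the same matrix with the same
nonzero diagonal coincide (`toeplitz_eq_of_pow_eq`). Jordan decompositions exist by the structure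
theorem for finitely generated torsion modules over `ℂ[X]` (`nonempty_jordanDecomposition`).

As `A` is real, `q(B)` is real precisely when the values of `q` at the eigenvalues commute with
complex conjugation. A real primary root therefore amounts to a free choice of a `p`-th root for
each eigenvalue in the open upper half plane and of a real `p`-th root for each real eigenvalue
(`encard_realPrimaryRoots`). A positive real number has two real `p`-th roots if `p` is even, a
negative one has none, and every real number has one if `p` is odd; the product of these numbers is
the count.
-/

/-! ### Upper triangular Toeplitz matrices as values of power series -/

/-- The algebra homomorphism sending a power series `F` to `F(N)`, where `N` is the `m × m`
nilpotent Jordan block: the upper triangular Toeplitz matrix whose `(a, b)` entry is the coefficient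
of `F` of index `b - a`. -/
noncomputable def toeplitz (m : ℕ) : PowerSeries ℂ →ₐ[ℂ] Matrix (Fin m) (Fin m) ℂ where
  toFun F := Matrix.of fun a b => if a ≤ b then PowerSeries.coeff ((b : ℕ) - a) F else 0
  map_one' := by
    ext a b
    by_cases hab : a = b
    · simp [hab, Matrix.one_apply]
    · simp only [Matrix.of_apply, Matrix.one_apply, hab, if_false, PowerSeries.coeff_one]
      split_ifs with h1 h2
      · exact absurd (Fin.ext (by have : (a : ℕ) ≤ b := h1; omega)) hab
      · rfl
      · rfl
  map_zero' := by ext a b; simp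
  map_add' F G := by
    ext a b
    simp only [Matrix.of_apply, Matrix.add_apply, map_add]
    split_ifs <;> simp
  map_mul' F G := by
    ext a b
    rw [Matrix.mul_apply]
    simp only [Matrix.of_apply, Fin.le_def]
    rw [Fin.sum_univ_eq_sum_range (fun c : ℕ =>
      (if (a : ℕ) ≤ c then PowerSeries.coeff (c - a) F else 0) *
        (if c ≤ (b : ℕ) then PowerSeries.coeff (b - c) G else 0)) m]
    by_cases hab : (a : ℕ) ≤ b
    · rw [if_pos hab, PowerSeries.coeff_mul, Finset.Nat.sum_antidiagonal_eq_sum_range_succ_mk]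
      have hsub : Finset.Ico (a : ℕ) (b + 1) ⊆ Finset.range m := by
        intro c hc
        have := b.isLt
        simp only [Finset.mem_Ico, Finset.mem_range] at hc ⊢
        omega
      rw [← Finset.sum_subset hsub, Finset.sum_Ico_eq_sum_range]
      · refine Finset.sum_congr (by congr 1; omega) fun k hk => ?_
        rw [Finset.mem_range] at hk
        rw [if_pos (by omega), if_pos (by omega)]
        congr 3 <;> omega
      · intro c _ hc
        simp only [Finset.mem_Ico, not_and_or, not_le, not_lt] at hc
        rcases hc with hc | hc
        · rw [if_neg (by omega), zero_mul]
        · rw [if_neg (by omega : ¬ c ≤ (b : ℕ)), mul_zero]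
    · rw [if_neg hab]
      refine (Finset.sum_eq_zero fun c _ => ?_).symm
      by_cases hc : (a : ℕ) ≤ c
      · rw [if_neg (by omega : ¬ c ≤ (b : ℕ)), mul_zero]
      · rw [if_neg hc, zero_mul]
  commutes' r := by
    ext a b
    by_cases hab : a = b
    · simp [hab, Matrix.algebraMap_matrix_apply]
    · simp only [Matrix.of_apply, Matrix.algebraMap_matrix_apply, hab, if_false,
        PowerSeries.algebraMap_apply, PowerSeries.coeff_C]
      split_ifs with h1 h2
      · exact absurd (Fin.ext (by have : (a : ℕ) ≤ b := h1; omega)) hab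
      · rfl
      · rfl

theorem toeplitz_apply {m : ℕ} (F : PowerSeries ℂ) (a b : Fin m) :
    toeplitz m F a b = if a ≤ b then PowerSeries.coeff ((b : ℕ) - a) F else 0 := rfl

theorem toeplitz_C_add_X (m : ℕ) (μ : ℂ) :
    toeplitz m (PowerSeries.C μ + PowerSeries.X) = jordanBlock m μ := by
  ext a b
  rw [toeplitz_apply, jordanBlock, Matrix.of_apply]
  simp only [map_add, PowerSeries.coeff_C, PowerSeries.coeff_X, Fin.le_def, Fin.ext_iff]
  split_ifs <;> first | omega | simp

/-- On a Jordan block, a polynomial acts through its Taylor expansion at the eigenvalue. -/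
theorem aeval_jordanBlock (m : ℕ) (μ : ℂ) (q : Polynomial ℂ) :
    Polynomial.aeval (jordanBlock m μ) q =
      toeplitz m (Polynomial.aeval (PowerSeries.C μ + PowerSeries.X) q) := by
  rw [← toeplitz_C_add_X, Polynomial.aeval_algHom_apply]

theorem constantCoeff_aeval_C_add_X (μ : ℂ) (q : Polynomial ℂ) :
    PowerSeries.constantCoeff (Polynomial.aeval (PowerSeries.C μ + PowerSeries.X) q) =
      q.eval μ := by
  rw [Polynomial.aeval_def, Polynomial.hom_eval₂, Polynomial.eval]
  congr 1
  simp

theorem eval_eq_zero_of_aeval_jordanBlock {m : ℕ} (hm : 0 < m) {μ : ℂ} {q : Polynomial ℂ}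
    (h : Polynomial.aeval (jordanBlock m μ) q = 0) : q.eval μ = 0 := by
  have := congrFun (congrFun h ⟨0, hm⟩) ⟨0, hm⟩
  rw [aeval_jordanBlock, toeplitz_apply, if_pos le_rfl] at this
  rw [← constantCoeff_aeval_C_add_X]
  simpa using this

/-- Two commuting `p`-th roots of the same Toeplitz matrix with the same nonzero diagonal agree:
`Fᵖ - Gᵖ` is the product of `F - G` with a power series with constant coefficient `p cᵖ⁻¹`. -/
theorem toeplitz_eq_of_pow_eq {m p : ℕ} (hp : 0 < p) {F G : PowerSeries ℂ}
    (h : toeplitz m F ^ p = toeplitz m G ^ p)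
    (hc : PowerSeries.constantCoeff F = PowerSeries.constantCoeff G)
    (h0 : PowerSeries.constantCoeff F ≠ 0) : toeplitz m F = toeplitz m G := by
  set W : PowerSeries ℂ := ∑ i ∈ Finset.range p, F ^ i * G ^ (p - 1 - i) with hW
  have hWc : PowerSeries.constantCoeff W =
      p * PowerSeries.constantCoeff F ^ (p - 1) := by
    rw [hW, map_sum, Finset.sum_congr rfl (g := fun _ => PowerSeries.constantCoeff F ^ (p - 1)),
      Finset.sum_const, Finset.card_range, nsmul_eq_mul]
    intro i hi
    rw [Finset.mem_range] at hi
    rw [map_mul, map_pow, map_pow, ← hc, ← pow_add]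
    congr 1
    omega
  have hWu : IsUnit W := by
    rw [PowerSeries.isUnit_iff_constantCoeff, hWc, isUnit_iff_ne_zero]
    exact mul_ne_zero (by exact_mod_cast hp.ne') (pow_ne_zero _ h0)
  have key : toeplitz m (F - G) * toeplitz m W = 0 := by
    rw [← map_mul, (Commute.all F G).mul_geom_sum₂ p, map_sub, map_pow, map_pow, h, sub_self]
  rw [(hWu.map (toeplitz m)).mul_left_eq_zero, map_sub, sub_eq_zero] at key
  exact key

/-! ### The Taylor series of the branches of the root function -/

/-- The Taylor series at `μ` of the branch `f_j` of the `p`-th root function. -/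
noncomputable def rootBranchSeries (p j : ℕ) (μ : ℂ) : PowerSeries ℂ :=
  PowerSeries.mk fun k => rootBranchDeriv p j k μ / (k.factorial : ℂ)

theorem toeplitz_rootBranchSeries (p j m : ℕ) (μ : ℂ) :
    toeplitz m (rootBranchSeries p j μ) = rootBranchJordanBlock p j m μ := by
  ext a b
  simp [toeplitz_apply, rootBranchSeries, rootBranchJordanBlock]

theorem constantCoeff_rootBranchSeries (p j : ℕ) (μ : ℂ) :
    PowerSeries.constantCoeff (rootBranchSeries p j μ) = rootBranch p j μ := by
  rw [← PowerSeries.coeff_zero_eq_constantCoeff_apply, rootBranchSeries, PowerSeries.coeff_mk,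
    rootBranchDeriv_zero]
  simp

theorem rootBranch_eq_cpow {p : ℕ} (hp : 0 < p) (j : ℕ) {μ : ℂ} (hμ : μ ≠ 0) :
    rootBranch p j μ = Complex.exp (2 * Real.pi * j * Complex.I / p) * μ ^ ((1 : ℂ) / p) := by
  rw [← rootBranchDeriv_zero, rootBranchDeriv_eq_cpow hp j 0 hμ]
  simp

theorem rootBranch_pow {p : ℕ} (hp : 0 < p) (j : ℕ) {μ : ℂ} (hμ : μ ≠ 0) :
    rootBranch p j μ ^ p = μ := by
  have hp' : (p : ℂ) ≠ 0 := by exact_mod_cast hp.ne'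
  rw [rootBranch_eq_cpow hp j hμ, mul_pow, ← Complex.exp_nat_mul, one_div,
    Complex.cpow_nat_inv_pow _ hp.ne', mul_div_cancel₀ _ hp',
    show (2 * (Real.pi : ℂ) * j * Complex.I) = j * (2 * Real.pi * Complex.I) by ring,
    Complex.exp_nat_mul_two_pi_mul_I, one_mul]

/-- The branches `f_0, …, f_{p-1}` exhaust the `p`-th roots. -/
theorem exists_rootBranch_eq {p : ℕ} (hp : 0 < p) {μ w : ℂ} (hμ : μ ≠ 0) (hw : w ^ p = μ) :
    ∃ j : Fin p, rootBranch p j μ = w := by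
  have : NeZero p := ⟨hp.ne'⟩
  have hζ := Complex.isPrimitiveRoot_exp p hp.ne'
  have h0 : rootBranch p 0 μ ≠ 0 := by
    intro h
    have := rootBranch_pow hp 0 hμ
    rw [h, zero_pow hp.ne'] at this
    exact hμ this.symm
  obtain ⟨i, hi, hi'⟩ := hζ.eq_pow_of_pow_eq_one (ξ := w / rootBranch p 0 μ)
    (by rw [div_pow, hw, rootBranch_pow hp 0 hμ, div_self hμ])
  refine ⟨⟨i, hi⟩, ?_⟩
  rw [eq_div_iff h0] at hi'
  rw [← hi', rootBranch_eq_cpow hp i hμ, rootBranch_eq_cpow hp 0 hμ, ← Complex.exp_nat_mul]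
  simp only [Nat.cast_zero, mul_zero, zero_mul, zero_div, Complex.exp_zero, one_mul]
  congr 2
  ring

theorem descPochhammer_smeval_eq_prod_range (k : ℕ) (x : ℂ) :
    (descPochhammer ℤ k).smeval x = ∏ i ∈ Finset.range k, (x - i) := by
  induction k with
  | zero => simp
  | succ k ih =>
    rw [descPochhammer_succ_right, Polynomial.smeval_mul, ih, Finset.prod_range_succ,
      Polynomial.smeval_sub, Polynomial.smeval_X, Polynomial.smeval_natCast]
    simp

/-- The Taylor series of a branch is a rescaled binomial series. -/
theorem rootBranchSeries_eq_binomialSeries {p : ℕ} (hp : 0 < p) (j : ℕ) {μ : ℂ} (hμ : μ ≠ 0) :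
    rootBranchSeries p j μ = PowerSeries.C (rootBranch p j μ) *
      PowerSeries.rescale μ⁻¹ (PowerSeries.binomialSeries ℂ ((1 : ℂ) / p)) := by
  have hp' : (p : ℂ) ≠ 0 := by exact_mod_cast hp.ne'
  ext k
  rw [rootBranchSeries, PowerSeries.coeff_mk, PowerSeries.coeff_C_mul, PowerSeries.coeff_rescale,
    PowerSeries.binomialSeries_coeff, rootBranchDeriv_eq_cpow hp j k hμ, rootBranch_eq_cpow hp j hμ,
    Ring.choose_eq_smul, descPochhammer_smeval_eq_prod_range,
    show (1 - (k : ℂ) * p) / p = 1 / p - k by field_simp, Complex.cpow_sub _ _ hμ,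
    Complex.cpow_natCast]
  have hprod : ∏ i ∈ Finset.range k, ((1 : ℂ) / p - i) =
      1 / (p : ℂ) ^ k * ∏ i ∈ Finset.range k, (1 - (i : ℂ) * p) := by
    rw [← one_div_pow, ← Finset.card_range k, ← Finset.prod_const, Finset.card_range,
      ← Finset.prod_mul_distrib]
    refine Finset.prod_congr rfl fun i _ => ?_
    field_simp
  rw [hprod, smul_eq_mul, smul_eq_mul, mul_one, inv_pow]
  ring

theorem rootBranchSeries_pow {p : ℕ} (hp : 0 < p) (j : ℕ) {μ : ℂ} (hμ : μ ≠ 0) :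
    rootBranchSeries p j μ ^ p = PowerSeries.C μ + PowerSeries.X := by
  have hp' : (p : ℂ) ≠ 0 := by exact_mod_cast hp.ne'
  have hb : ∀ d : ℕ, PowerSeries.binomialSeries ℂ ((1 : ℂ) / p) ^ d =
      PowerSeries.binomialSeries ℂ ((d : ℂ) * (1 / p)) := by
    intro d
    induction d with
    | zero => simp
    | succ d ih =>
      rw [pow_succ, ih, ← PowerSeries.binomialSeries_add]
      congr 1
      push_cast
      ring
  rw [rootBranchSeries_eq_binomialSeries hp j hμ, mul_pow, ← map_pow, ← map_pow,
    rootBranch_pow hp j hμ, hb, mul_one_div_cancel hp', ← Nat.cast_one,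
    PowerSeries.binomialSeries_nat, pow_one, map_add, map_one, PowerSeries.rescale_X, mul_add,
    mul_one, ← mul_assoc, ← map_mul, mul_inv_cancel₀ hμ, map_one, one_mul]

/-- Any polynomial `p`-th root of a nonsingular Jordan block is a value of the branch of the
root function selected by its eigenvalue. -/
theorem aeval_jordanBlock_eq_rootBranchJordanBlock {p j m : ℕ} (hp : 0 < p) {μ : ℂ} (hμ : μ ≠ 0)
    {q : Polynomial ℂ} (hq : Polynomial.aeval (jordanBlock m μ) q ^ p = jordanBlock m μ)
    (hj : q.eval μ = rootBranch p j μ) :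
    Polynomial.aeval (jordanBlock m μ) q = rootBranchJordanBlock p j m μ := by
  have hc : PowerSeries.constantCoeff (Polynomial.aeval (PowerSeries.C μ + PowerSeries.X) q) =
      rootBranch p j μ := by rw [constantCoeff_aeval_C_add_X, hj]
  rw [aeval_jordanBlock, ← toeplitz_rootBranchSeries]
  refine toeplitz_eq_of_pow_eq hp ?_ ?_ ?_
  · rw [← aeval_jordanBlock, hq, ← map_pow, rootBranchSeries_pow hp j hμ, toeplitz_C_add_X]
  · rw [hc, constantCoeff_rootBranchSeries]
  · rw [hc]
    intro h
    have := rootBranch_pow hp j hμ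
    rw [h, zero_pow hp.ne'] at this
    exact hμ this.symm

/-! ### Existence of Jordan decompositions -/

theorem sum_jordanBlock_smul {V : Type*} [AddCommGroup V] [Module ℂ V] {m : ℕ} (μ : ℂ)
    (v : Fin m → V) (k : Fin m) :
    ∑ a, jordanBlock m μ a k • v a =
      μ • v k + if h : 0 < (k : ℕ) then v ⟨k - 1, by omega⟩ else 0 := by
  have hJ : ∀ a, jordanBlock m μ a k • v a =
      (if a = k then μ • v a else 0) + (if (a : ℕ) + 1 = k then v a else 0) := by
    intro a
    rw [jordanBlock, Matrix.of_apply]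
    split_ifs with h1 h2 h2
    · subst h1; omega
    · simp
    · simp
    · simp
  rw [Finset.sum_congr rfl fun a _ => hJ a, Finset.sum_add_distrib, Finset.sum_ite_eq' Finset.univ]
  simp only [Finset.mem_univ, if_true]
  congr 1
  split_ifs with h
  · rw [Finset.sum_eq_single ⟨(k : ℕ) - 1, by omega⟩]
    · rw [if_pos]
      simp only
      omega
    · intro a _ ha
      rw [if_neg]
      intro h'
      exact ha (Fin.ext (by simp only; omega))
    · simp
  · exact Finset.sum_eq_zero fun a _ => if_neg (by omega)

/-- On `ℂ[X] ⧸ ((X - μ)ᵉ)`, multiplication by `X` is a Jordan block in the basis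
`(X - μ)ᵉ⁻¹, …, X - μ, 1`. -/
theorem exists_jordan_basis_quotient (μ : ℂ) (e : ℕ) (I : Ideal (Polynomial ℂ))
    (hI : I = Ideal.span {(Polynomial.X - Polynomial.C μ) ^ e}) :
    ∃ b : Module.Basis (Fin e) ℂ (Polynomial ℂ ⧸ I),
      ∀ k, (Polynomial.X : Polynomial ℂ) • b k = ∑ a, jordanBlock e μ a k • b a := by
  classical
  set Y : Polynomial ℂ := Polynomial.X - Polynomial.C μ with hY
  have hmonic : (Y ^ e).Monic := (Polynomial.monic_X_sub_C μ).pow e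
  let v : Fin e → Polynomial ℂ ⧸ I := fun k => Ideal.Quotient.mk I (Y ^ (e - 1 - (k : ℕ)))
  have hli : LinearIndependent ℂ v := by
    rw [Fintype.linearIndependent_iff]
    intro c hc i
    have h1 : Ideal.Quotient.mk I (∑ k : Fin e, Polynomial.C (c k) * Y ^ (e - 1 - (k : ℕ))) = 0 := by
      rw [← hc, map_sum]
      refine Finset.sum_congr rfl fun k _ => ?_
      rw [← Polynomial.smul_eq_C_mul]
      rfl
    rw [Ideal.Quotient.eq_zero_iff_mem, hI, Ideal.mem_span_singleton] at h1
    -- Translating by `μ` turns powers of `X - μ` into powers of `X`.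
    have h2 := map_dvd (Polynomial.compRingHom (Polynomial.X + Polynomial.C μ)) h1
    have hYc : Polynomial.compRingHom (Polynomial.X + Polynomial.C μ) Y = Polynomial.X := by
      simp [hY]
    rw [map_pow, hYc, map_sum] at h2
    simp only [map_mul, map_pow, hYc] at h2
    have h3 := Polynomial.X_pow_dvd_iff.mp h2 (e - 1 - i) (by omega)
    rw [Polynomial.finsetSum_coeff, Finset.sum_eq_single i] at h3
    · simpa using h3
    · intro k _ hk
      simp only [Polynomial.coe_compRingHom_apply, Polynomial.C_comp, Polynomial.coeff_C_mul,
        Polynomial.coeff_X_pow]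
      rw [if_neg, mul_zero]
      intro h
      exact hk (Fin.ext (by omega))
    · simp
  have hfin : Module.Finite ℂ (Polynomial ℂ ⧸ I) := hI ▸ hmonic.finite_quotient
  have hspan : Submodule.span ℂ (Set.range v) = ⊤ := by
    refine hli.span_eq_top_of_card_eq_finrank' ?_
    subst hI
    rw [finrank_quotient_span_eq_natDegree, Fintype.card_fin, hY, Polynomial.natDegree_pow,
      Polynomial.natDegree_X_sub_C, mul_one]
  refine ⟨Module.Basis.mk hli hspan.ge, fun k => ?_⟩
  rw [sum_jordanBlock_smul]
  simp only [Module.Basis.mk_apply]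
  have hX : (Polynomial.X : Polynomial ℂ) • v k =
      μ • v k + Ideal.Quotient.mk I (Y ^ (e - 1 - (k : ℕ) + 1)) := by
    change Ideal.Quotient.mk I (Polynomial.X * Y ^ (e - 1 - (k : ℕ))) =
      Ideal.Quotient.mk I (μ • Y ^ (e - 1 - (k : ℕ))) + _
    rw [← map_add, Polynomial.smul_eq_C_mul, pow_succ, hY]
    congr 1
    ring
  rw [hX]
  congr 1
  split_ifs with h
  · change Ideal.Quotient.mk I _ = Ideal.Quotient.mk I _
    congr 2
    simp only
    omega
  · rw [Ideal.Quotient.eq_zero_iff_mem, hI, Ideal.mem_span_singleton]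
    exact pow_dvd_pow _ (by omega)

theorem exists_jordan_basis_quotient_irreducible {q : Polynomial ℂ} (hq : Irreducible q) (e : ℕ) :
    ∃ (μ : ℂ) (b : Module.Basis (Fin e) ℂ (Polynomial ℂ ⧸ Ideal.span {q ^ e})),
      ∀ k, (Polynomial.X : Polynomial ℂ) • b k = ∑ a, jordanBlock e μ a k • b a := by
  obtain ⟨μ, hμ⟩ := IsAlgClosed.exists_root q
    (by rw [IsAlgClosed.degree_eq_one_of_irreducible ℂ hq]; exact one_ne_zero)
  refine ⟨μ, exists_jordan_basis_quotient μ e _ ?_⟩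
  rw [Ideal.span_singleton_eq_span_singleton]
  exact (((Polynomial.irreducible_X_sub_C μ).associated_of_dvd hq
    (Polynomial.dvd_iff_isRoot.mpr hμ)).symm).pow_pow

/-- A Jordan basis, in which empty blocks are still allowed. -/
theorem exists_jordan_basis {n : ℕ} (B : Matrix (Fin n) (Fin n) ℂ) :
    ∃ (ι : Type) (_ : Fintype ι) (size : ι → ℕ) (eig : ι → ℂ)
      (b : Module.Basis (Σ i, Fin (size i)) ℂ (Fin n → ℂ)),
      ∀ i k, B.mulVec (b ⟨i, k⟩) =
        ∑ a, jordanBlock (size i) (eig i) a k • b ⟨i, a⟩ := by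
  classical
  obtain ⟨ι, hι, q, hq, e, ⟨f⟩⟩ := Module.equiv_directSum_of_isTorsion
    (Module.AEval.isTorsion_of_finiteDimensional ℂ (Fin n → ℂ) (Matrix.toLin' B))
  choose μ b hb using fun i => exists_jordan_basis_quotient_irreducible (hq i) (e i)
  let F : Module.AEval' (Matrix.toLin' B) ≃ₗ[Polynomial ℂ]
      Π i, Polynomial ℂ ⧸ Ideal.span {q i ^ e i} :=
    f.trans (DirectSum.linearEquivFunOnFintype (Polynomial ℂ) ι
      fun i => Polynomial ℂ ⧸ Ideal.span {q i ^ e i})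
  let g : (Fin n → ℂ) ≃ₗ[ℂ] Π i, Polynomial ℂ ⧸ Ideal.span {q i ^ e i} :=
    (Module.AEval'.of (Matrix.toLin' B)).trans (F.restrictScalars ℂ)
  let b' : Module.Basis (Σ i, Fin (e i)) ℂ (Π i, Polynomial ℂ ⧸ Ideal.span {q i ^ e i}) :=
    Pi.basis b
  have hb' : ∀ i k, b' ⟨i, k⟩ = Pi.single i (b i k) := fun i k => by
    simp [b', Pi.basis_apply]
  refine ⟨ι, hι, e, μ, b'.map g.symm, fun i k => ?_⟩
  apply g.injective
  have hg : ∀ v, g (B.mulVec v) = (Polynomial.X : Polynomial ℂ) • g v := by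
    intro v
    change F (Module.AEval'.of (Matrix.toLin' B) (Matrix.toLin' B v)) =
      (Polynomial.X : Polynomial ℂ) • F (Module.AEval'.of (Matrix.toLin' B) v)
    rw [← map_smul, Module.AEval'.X_smul_of]
  rw [hg, map_sum]
  simp only [map_smul, Module.Basis.map_apply, LinearEquiv.apply_symm_apply, hb']
  rw [← Pi.single_smul, hb i k]
  simp only [← Pi.single_smul]
  exact map_sum (AddMonoidHom.single (fun i => Polynomial ℂ ⧸ Ideal.span {q i ^ e i}) i) _ _

theorem nonempty_jordanDecomposition {n : ℕ} (B : Matrix (Fin n) (Fin n) ℂ) :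
    Nonempty (JordanDecomposition B) := by
  classical
  obtain ⟨ι, _, size, eig, b, hb⟩ := exists_jordan_basis B
  let ε : Fin (Fintype.card {i // 0 < size i}) ≃ {i // 0 < size i} := (Fintype.equivFin _).symm
  let σ : (Σ k, Fin (size (ε k))) ≃ Σ i, Fin (size i) :=
    Equiv.ofBijective (fun s => ⟨ε s.1, s.2⟩) <| by
      constructor
      · rintro ⟨k, x⟩ ⟨k', x'⟩ h
        obtain rfl : k = k' := ε.injective (Subtype.ext (congrArg Sigma.fst h))
        simpa using h
      · rintro ⟨i, x⟩
        obtain ⟨k, hk⟩ := ε.surjective ⟨i, x.pos⟩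
        have hk' : (ε k : ι) = i := by rw [hk]
        subst hk'
        exact ⟨⟨k, x⟩, rfl⟩
  let b' := b.reindex σ.symm
  have hb' : ∀ k x, b' ⟨k, x⟩ = b ⟨ε k, x⟩ := fun k x => by
    rw [Module.Basis.reindex_apply, Equiv.symm_symm]
    rfl
  let e := b'.indexEquiv (Pi.basisFun ℂ (Fin n))
  let Z : Matrix (Fin n) (Fin n) ℂ := Matrix.of fun r c => b' (e.symm c) r
  have hZ : IsUnit Z.det := by
    have : Z = (Pi.basisFun ℂ (Fin n)).toMatrix (b'.reindex e) := by
      ext r c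
      simp [Z, Module.Basis.toMatrix_apply]
    rw [this, ← Matrix.isUnit_iff_isUnit_det]
    have := (Pi.basisFun ℂ (Fin n)).invertibleToMatrix (b'.reindex e)
    exact isUnit_of_invertible _
  refine ⟨⟨_, fun k => size (ε k), fun k => (ε k).2, fun k => eig (ε k), e, Z, hZ, ?_⟩⟩
  suffices h : B * Z = Z * Matrix.reindex e e
      (Matrix.blockDiagonal' fun k => jordanBlock (size (ε k)) (eig (ε k))) by
    rw [← h, Matrix.mul_nonsing_inv_cancel_right _ _ hZ]
  ext r c
  obtain ⟨⟨k, x⟩, rfl⟩ := e.surjective c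
  have hcol : (B * Z) r (e ⟨k, x⟩) = B.mulVec (b' ⟨k, x⟩) r := by
    simp [Matrix.mul_apply, Matrix.mulVec, dotProduct, Z]
  rw [hcol, hb', hb, Finset.sum_apply, Matrix.mul_apply, ← Equiv.sum_comp e,
    Fintype.sum_sigma, Finset.sum_eq_single k]
  · refine Finset.sum_congr rfl fun a _ => ?_
    rw [Pi.smul_apply, smul_eq_mul, mul_comm]
    have hZa : Z r (e ⟨k, a⟩) = b ⟨ε k, a⟩ r := by
      change b' (e.symm (e ⟨k, a⟩)) r = _
      rw [Equiv.symm_apply_apply, hb']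
    rw [hZa]
    simp [Matrix.blockDiagonal'_apply]
  · intro i _ hi
    refine Finset.sum_eq_zero fun a _ => ?_
    simp [Matrix.blockDiagonal'_apply, hi]
  · simp

/-! ### Primary roots are the polynomial roots -/

namespace JordanDecomposition

variable {n : ℕ} {B : Matrix (Fin n) (Fin n) ℂ}

/-- The algebra homomorphism `(Mᵢ)ᵢ ↦ Z (⨁ i, Mᵢ) Z⁻¹` attached to a Jordan decomposition. -/
noncomputable def conjHom (D : JordanDecomposition B) :
    (Π i, Matrix (Fin (D.size i)) (Fin (D.size i)) ℂ) →ₐ[ℂ] Matrix (Fin n) (Fin n) ℂ where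
  toFun M := D.Z * Matrix.reindex D.e D.e (Matrix.blockDiagonal' M) * D.Z⁻¹
  map_one' := by
    simp [Matrix.mul_nonsing_inv _ D.isUnit_det]
  map_zero' := by simp
  map_add' M N := by
    rw [Matrix.blockDiagonal'_add]
    exact (congrArg (· * D.Z⁻¹) (Matrix.mul_add D.Z _ _)).trans (Matrix.add_mul _ _ _)
  map_mul' M N := by
    have h : Matrix.reindex D.e D.e (Matrix.blockDiagonal' (M * N)) =
        Matrix.reindex D.e D.e (Matrix.blockDiagonal' M) *
          Matrix.reindex D.e D.e (Matrix.blockDiagonal' N) := by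
      rw [Pi.mul_def, Matrix.blockDiagonal'_mul]
      exact map_mul (Matrix.reindexAlgEquiv ℂ ℂ D.e) _ _
    rw [h]
    simp only [Matrix.mul_assoc]
    rw [Matrix.nonsing_inv_mul_cancel_left _ _ D.isUnit_det]
  commutes' r := by
    have h : Matrix.reindex D.e D.e (Matrix.blockDiagonal' (algebraMap ℂ
        (Π i, Matrix (Fin (D.size i)) (Fin (D.size i)) ℂ) r)) = r • 1 := by
      rw [Algebra.algebraMap_eq_smul_one, Matrix.blockDiagonal'_smul, Matrix.blockDiagonal'_one]
      exact (map_smul (Matrix.reindexAlgEquiv ℂ ℂ D.e) r 1).trans (by rw [map_one])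
    rw [h, Matrix.mul_smul, mul_one, Matrix.smul_mul, Matrix.mul_nonsing_inv _ D.isUnit_det,
      Algebra.algebraMap_eq_smul_one]

theorem conjHom_apply (D : JordanDecomposition B)
    (M : Π i, Matrix (Fin (D.size i)) (Fin (D.size i)) ℂ) :
    D.conjHom M = D.Z * Matrix.reindex D.e D.e (Matrix.blockDiagonal' M) * D.Z⁻¹ := rfl

theorem conjHom_injective (D : JordanDecomposition B) : Function.Injective D.conjHom := by
  intro M N h
  have h1 := congrArg (fun X => D.Z⁻¹ * X * D.Z) h
  simp only [conjHom_apply, Matrix.mul_assoc, Matrix.nonsing_inv_mul _ D.isUnit_det, mul_one,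
    Matrix.nonsing_inv_mul_cancel_left _ _ D.isUnit_det] at h1
  exact Matrix.blockDiagonal'_injective ((Matrix.reindex D.e D.e).injective h1)

theorem aeval_eq_conjHom (D : JordanDecomposition B) (q : Polynomial ℂ) :
    Polynomial.aeval B q =
      D.conjHom fun i => Polynomial.aeval (jordanBlock (D.size i) (D.eig i)) q := by
  have hB : B = D.conjHom fun i => jordanBlock (D.size i) (D.eig i) := D.eq
  conv_lhs => rw [hB]
  rw [Polynomial.aeval_algHom_apply]
  congr 1
  funext i
  exact (Polynomial.aeval_algHom_apply (Pi.evalAlgHom ℂ _ i) _ q).symm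

theorem aeval_eq_zero_iff (D : JordanDecomposition B) (q : Polynomial ℂ) :
    Polynomial.aeval B q = 0 ↔
      ∀ i, Polynomial.aeval (jordanBlock (D.size i) (D.eig i)) q = 0 := by
  rw [D.aeval_eq_conjHom, map_eq_zero_iff _ D.conjHom_injective, funext_iff]
  rfl

theorem aeval_pow_eq_self_iff (D : JordanDecomposition B) (p : ℕ) (q : Polynomial ℂ) :
    Polynomial.aeval B q ^ p = B ↔
      ∀ i, Polynomial.aeval (jordanBlock (D.size i) (D.eig i)) q ^ p =
        jordanBlock (D.size i) (D.eig i) := by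
  have key : ∀ {m : ℕ} (M : Matrix (Fin m) (Fin m) ℂ),
      Polynomial.aeval M (q ^ p - Polynomial.X) = 0 ↔ Polynomial.aeval M q ^ p = M := by
    intro m M
    rw [map_sub, map_pow, Polynomial.aeval_X, sub_eq_zero]
  simp only [← key]
  exact D.aeval_eq_zero_iff _

theorem eig_mem_spectrum (D : JordanDecomposition B) (i : Fin D.t) : D.eig i ∈ spectrum ℂ B := by
  rw [Matrix.mem_spectrum_iff_isRoot_charpoly]
  exact eval_eq_zero_of_aeval_jordanBlock (D.size_pos i)
    ((D.aeval_eq_zero_iff _).mp (Matrix.aeval_self_charpoly B) i)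

end JordanDecomposition

section PolynomialRoots

variable {n : ℕ} {B : Matrix (Fin n) (Fin n) ℂ}

theorem ne_zero_of_mem_spectrum (hB : IsUnit B.det) {μ : ℂ} (hμ : μ ∈ spectrum ℂ B) : μ ≠ 0 := by
  rintro rfl
  exact (spectrum.zero_notMem_iff ℂ).mpr ((Matrix.isUnit_iff_isUnit_det B).mpr hB) hμ

theorem eval_eq_zero_of_aeval_eq_zero {q : Polynomial ℂ} (hq : Polynomial.aeval B q = 0) {μ : ℂ}
    (hμ : μ ∈ spectrum ℂ B) : q.eval μ = 0 := by
  have h := spectrum.subset_polynomial_aeval B q ⟨μ, hμ, rfl⟩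
  rw [hq] at h
  by_contra h0
  refine h ?_
  change IsUnit (algebraMap ℂ (Matrix (Fin n) (Fin n) ℂ) (q.eval μ) - 0)
  rw [sub_zero]
  exact (isUnit_iff_ne_zero.mpr h0).map _

theorem eval_pow_eq_of_aeval_pow_eq {p : ℕ} {q : Polynomial ℂ}
    (hq : Polynomial.aeval B q ^ p = B) {μ : ℂ} (hμ : μ ∈ spectrum ℂ B) : q.eval μ ^ p = μ := by
  have := eval_eq_zero_of_aeval_eq_zero (q := q ^ p - Polynomial.X) (by simp [hq]) hμ
  simpa [sub_eq_zero] using this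

/-- A polynomial `p`-th root of a nonsingular matrix is determined by its values at the
eigenvalues. -/
theorem aeval_eq_of_eval_eq {p : ℕ} (hp : 0 < p) (hB : IsUnit B.det) {q₁ q₂ : Polynomial ℂ}
    (h₁ : Polynomial.aeval B q₁ ^ p = B) (h₂ : Polynomial.aeval B q₂ ^ p = B)
    (h : ∀ μ ∈ spectrum ℂ B, q₁.eval μ = q₂.eval μ) :
    Polynomial.aeval B q₁ = Polynomial.aeval B q₂ := by
  obtain ⟨D⟩ := nonempty_jordanDecomposition B
  rw [D.aeval_eq_conjHom, D.aeval_eq_conjHom]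
  congr 1
  funext i
  have hi := D.eig_mem_spectrum i
  have h0 := ne_zero_of_mem_spectrum hB hi
  obtain ⟨j, hj⟩ := exists_rootBranch_eq hp h0 (eval_pow_eq_of_aeval_pow_eq h₁ hi)
  rw [aeval_jordanBlock_eq_rootBranchJordanBlock hp h0 ((D.aeval_pow_eq_self_iff p q₁).mp h₁ i)
      hj.symm,
    aeval_jordanBlock_eq_rootBranchJordanBlock hp h0 ((D.aeval_pow_eq_self_iff p q₂).mp h₂ i)
      (by rw [← h _ hi, hj])]

/-- Every choice of `p`-th roots of the eigenvalues of a nonsingular matrix extends to a polynomial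
`p`-th root: modulo the characteristic polynomial, a Lagrange interpolant is a `p`-th root up to a
nilpotent error, which Newton's method removes. -/
theorem exists_aeval_pow_eq {p : ℕ} (hp : 0 < p) (hB : IsUnit B.det) (g : ℂ → ℂ)
    (hg : ∀ μ ∈ spectrum ℂ B, g μ ^ p = μ) :
    ∃ q : Polynomial ℂ, Polynomial.aeval B q ^ p = B ∧ ∀ μ ∈ spectrum ℂ B, q.eval μ = g μ := by
  classical
  set χ := B.charpoly with hχ
  have hsplit : χ = (χ.roots.map fun a => Polynomial.X - Polynomial.C a).prod := by
    have := (IsAlgClosed.splits χ).eq_prod_roots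
    rwa [hχ, B.charpoly_monic.leadingCoeff, map_one, one_mul] at this
  have hnil : ∀ q : Polynomial ℂ, (∀ μ ∈ spectrum ℂ B, q.eval μ = 0) →
      IsNilpotent (AdjoinRoot.mk χ q) := by
    intro q hq
    refine ⟨Multiset.card χ.roots, ?_⟩
    rw [← map_pow, AdjoinRoot.mk_eq_zero]
    conv_lhs => rw [hsplit]
    rw [← Multiset.prod_replicate, ← Multiset.map_const']
    refine Multiset.prod_dvd_prod_of_dvd _ _ fun a ha => ?_
    rw [Polynomial.dvd_iff_isRoot]
    exact hq a (Matrix.mem_spectrum_iff_isRoot_charpoly.mpr (Polynomial.isRoot_of_mem_roots ha))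
  set s : Finset ℂ := (Matrix.finite_spectrum B).toFinset with hs
  set q₀ : Polynomial ℂ := Lagrange.interpolate s id g
  have hq₀ : ∀ μ ∈ spectrum ℂ B, q₀.eval μ = g μ := fun μ hμ =>
    Lagrange.eval_interpolate_at_node g Function.injective_id.injOn
      ((Matrix.finite_spectrum B).mem_toFinset.mpr hμ)
  have hX : IsUnit (AdjoinRoot.mk χ Polynomial.X) := by
    have hcop : IsCoprime χ Polynomial.X := by
      refine ((Polynomial.irreducible_X.coprime_iff_not_dvd).mpr fun h => ?_).symm
      rw [Polynomial.X_dvd_iff, Polynomial.coeff_zero_eq_eval_zero] at h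
      exact ne_zero_of_mem_spectrum hB (Matrix.mem_spectrum_iff_isRoot_charpoly.mpr h) rfl
    obtain ⟨a, b, hab⟩ := hcop
    have := congrArg (AdjoinRoot.mk χ) hab
    rw [map_add, map_mul, map_mul, AdjoinRoot.mk_self, mul_zero, zero_add, map_one] at this
    exact IsUnit.of_mul_eq_one_right _ this
  have hN : IsNilpotent (AdjoinRoot.mk χ (q₀ ^ p - Polynomial.X)) :=
    hnil _ fun μ hμ => by simp [hq₀ μ hμ, hg μ hμ]
  have hu : IsUnit (AdjoinRoot.mk χ q₀) := by
    have h := hN.isUnit_add_left_of_commute hX (Commute.all _ _)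
    rw [← map_add, add_sub_cancel, map_pow] at h
    exact (isUnit_pow_iff hp.ne').mp h
  obtain ⟨r, ⟨hr, hr'⟩, -⟩ := Polynomial.existsUnique_nilpotent_sub_and_aeval_eq_zero
    (P := (Polynomial.X ^ p - Polynomial.C (AdjoinRoot.mk χ Polynomial.X) :
      Polynomial (AdjoinRoot χ))) (x := AdjoinRoot.mk χ q₀)
    (by simpa using hN)
    (by
      simp only [Polynomial.derivative_sub, Polynomial.derivative_X_pow, Polynomial.derivative_C,
        sub_zero, map_mul, map_pow, Polynomial.aeval_X, map_natCast]
      refine IsUnit.mul ?_ (hu.pow _)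
      have : IsUnit ((p : ℂ)) := isUnit_iff_ne_zero.mpr (by exact_mod_cast hp.ne')
      simpa using this.map (algebraMap ℂ (AdjoinRoot χ)))
  obtain ⟨q, rfl⟩ := AdjoinRoot.mk_surjective r
  have hqB : ∀ f : Polynomial ℂ, AdjoinRoot.mk χ f = 0 → Polynomial.aeval B f = 0 := by
    intro f hf
    rw [AdjoinRoot.mk_eq_zero] at hf
    exact Polynomial.aeval_eq_zero_of_dvd_aeval_eq_zero hf (Matrix.aeval_self_charpoly B)
  refine ⟨q, ?_, fun μ hμ => ?_⟩
  · have := hqB (q ^ p - Polynomial.X) (by simpa using hr')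
    simpa [sub_eq_zero] using this
  · obtain ⟨k, hk⟩ := hr
    have := eval_eq_zero_of_aeval_eq_zero (hqB ((q₀ - q) ^ k) (by simpa using hk)) hμ
    rw [Polynomial.eval_pow, Polynomial.eval_sub, hq₀ μ hμ] at this
    exact (sub_eq_zero.mp (eq_zero_of_pow_eq_zero this)).symm

/-- The primary `p`-th roots of a nonsingular matrix are its `p`-th roots which are polynomials
in it. -/
theorem isPrimaryRoot_iff {p : ℕ} (hp : 0 < p) (hB : IsUnit B.det)
    {X : Matrix (Fin n) (Fin n) ℂ} :
    IsPrimaryRoot p B X ↔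
      ∃ q : Polynomial ℂ, Polynomial.aeval B q ^ p = B ∧ X = Polynomial.aeval B q := by
  classical
  constructor
  · rintro ⟨-, D, j, hj, rfl⟩
    let g : ℂ → ℂ := fun μ =>
      if h : ∃ i, D.eig i = μ then rootBranch p (j h.choose) μ else rootBranch p 0 μ
    have hg : ∀ μ ∈ spectrum ℂ B, g μ ^ p = μ := by
      intro μ hμ
      have h0 := ne_zero_of_mem_spectrum hB hμ
      simp only [g]
      split_ifs <;> exact rootBranch_pow hp _ h0
    have hge : ∀ i, g (D.eig i) = rootBranch p (j i) (D.eig i) := by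
      intro i
      have h : ∃ k, D.eig k = D.eig i := ⟨i, rfl⟩
      simp only [g]
      rw [dif_pos h, hj _ _ h.choose_spec]
    obtain ⟨q, hq, hqg⟩ := exists_aeval_pow_eq hp hB g hg
    refine ⟨q, hq, ?_⟩
    rw [D.aeval_eq_conjHom, D.conjHom_apply]
    congr 4
    funext i
    have hi := D.eig_mem_spectrum i
    exact (aeval_jordanBlock_eq_rootBranchJordanBlock hp (ne_zero_of_mem_spectrum hB hi)
      ((D.aeval_pow_eq_self_iff p q).mp hq i) (by rw [hqg _ hi, hge])).symm
  · rintro ⟨q, hq, rfl⟩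
    obtain ⟨D⟩ := nonempty_jordanDecomposition B
    have hex : ∀ μ : ℂ, ∃ j : Fin p, μ ∈ spectrum ℂ B → rootBranch p j μ = q.eval μ := by
      intro μ
      by_cases hμ : μ ∈ spectrum ℂ B
      · obtain ⟨j, hj⟩ := exists_rootBranch_eq hp (ne_zero_of_mem_spectrum hB hμ)
          (eval_pow_eq_of_aeval_pow_eq hq hμ)
        exact ⟨j, fun _ => hj⟩
      · exact ⟨⟨0, hp⟩, fun h => absurd h hμ⟩
    choose j hj using hex
    refine ⟨hq, D, fun i => j (D.eig i), fun i k h => by simp only [h], ?_⟩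
    rw [D.aeval_eq_conjHom, D.conjHom_apply]
    congr 4
    funext i
    have hi := D.eig_mem_spectrum i
    exact aeval_jordanBlock_eq_rootBranchJordanBlock hp (ne_zero_of_mem_spectrum hB hi)
      ((D.aeval_pow_eq_self_iff p q).mp hq i) (hj _ hi).symm

end PolynomialRoots

/-! ### Real primary roots and conjugation -/

section RealRoots

theorem map_starRingEnd_aeval {n : ℕ} (A : Matrix (Fin n) (Fin n) ℝ) (q : Polynomial ℂ) :
    (Polynomial.aeval (A.map Complex.ofReal) q).map (starRingEnd ℂ) =
      Polynomial.aeval (A.map Complex.ofReal) (q.map (starRingEnd ℂ)) := by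
  have hA : (starRingEnd ℂ).mapMatrix (A.map Complex.ofReal) = A.map Complex.ofReal := by
    ext a b
    simp
  have hC : (starRingEnd ℂ).mapMatrix.comp (algebraMap ℂ (Matrix (Fin n) (Fin n) ℂ)) =
      (algebraMap ℂ (Matrix (Fin n) (Fin n) ℂ)).comp (starRingEnd ℂ) := by
    ext r a b
    by_cases h : a = b <;> simp [Matrix.algebraMap_matrix_apply, h]
  change (starRingEnd ℂ).mapMatrix _ = _
  rw [Polynomial.aeval_def, Polynomial.hom_eval₂, hA, hC, Polynomial.aeval_def,
    Polynomial.eval₂_map]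

theorem eval_map_starRingEnd (q : Polynomial ℂ) (μ : ℂ) :
    (q.map (starRingEnd ℂ)).eval (starRingEnd ℂ μ) = starRingEnd ℂ (q.eval μ) := by
  rw [Polynomial.eval_map, Polynomial.eval₂_at_apply]

variable {n : ℕ} {A : Matrix (Fin n) (Fin n) ℝ}

theorem mem_spectrum_map_ofReal_iff {μ : ℂ} :
    μ ∈ spectrum ℂ (A.map Complex.ofReal) ↔ Polynomial.aeval μ A.charpoly = 0 := by
  rw [Matrix.mem_spectrum_iff_isRoot_charpoly]
  have : (A.map Complex.ofReal).charpoly = A.charpoly.map Complex.ofRealHom :=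
    Matrix.charpoly_map A Complex.ofRealHom
  rw [this, Polynomial.IsRoot, Polynomial.eval_map]
  rfl

theorem ofReal_mem_spectrum_map_ofReal_iff {x : ℝ} :
    (x : ℂ) ∈ spectrum ℂ (A.map Complex.ofReal) ↔ x ∈ spectrum ℝ A := by
  rw [mem_spectrum_map_ofReal_iff, Matrix.mem_spectrum_iff_isRoot_charpoly, Polynomial.IsRoot,
    ← Complex.coe_algebraMap, Polynomial.aeval_algebraMap_apply, Polynomial.coe_aeval_eq_eval]
  simp

theorem conj_mem_spectrum_map_ofReal {μ : ℂ} (hμ : μ ∈ spectrum ℂ (A.map Complex.ofReal)) :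
    starRingEnd ℂ μ ∈ spectrum ℂ (A.map Complex.ofReal) := by
  rw [mem_spectrum_map_ofReal_iff] at hμ ⊢
  rw [Polynomial.aeval_conj, hμ, map_zero]

theorem isUnit_det_map_ofReal (hA : IsUnit A.det) : IsUnit (A.map Complex.ofReal).det := by
  have : (A.map Complex.ofReal).det = Complex.ofRealHom A.det :=
    (RingHom.map_det Complex.ofRealHom A).symm
  rw [this]
  exact hA.map _

theorem eval_conj_of_map_ofReal_eq_aeval {X : Matrix (Fin n) (Fin n) ℝ} {q : Polynomial ℂ}
    (h : X.map Complex.ofReal = Polynomial.aeval (A.map Complex.ofReal) q) {μ : ℂ}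
    (hμ : μ ∈ spectrum ℂ (A.map Complex.ofReal)) :
    q.eval (starRingEnd ℂ μ) = starRingEnd ℂ (q.eval μ) := by
  have hX : (X.map Complex.ofReal).map (starRingEnd ℂ) = X.map Complex.ofReal := by
    ext a b
    simp
  have h0 : Polynomial.aeval (A.map Complex.ofReal) (q.map (starRingEnd ℂ) - q) = 0 := by
    rw [map_sub, ← map_starRingEnd_aeval, ← h, hX, sub_self]
  have := eval_eq_zero_of_aeval_eq_zero h0 (conj_mem_spectrum_map_ofReal hμ)
  rw [Polynomial.eval_sub, eval_map_starRingEnd, sub_eq_zero] at this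
  exact this.symm

/-- A choice of `p`-th roots of the eigenvalues that commutes with conjugation comes from a real
polynomial root: the conjugate root takes the same values at the eigenvalues. -/
theorem exists_real_aeval_pow_eq {p : ℕ} (hp : 0 < p) (hA : IsUnit A.det) (g : ℂ → ℂ)
    (hg : ∀ μ ∈ spectrum ℂ (A.map Complex.ofReal), g μ ^ p = μ)
    (hgc : ∀ μ ∈ spectrum ℂ (A.map Complex.ofReal), g (starRingEnd ℂ μ) = starRingEnd ℂ (g μ)) :
    ∃ (X : Matrix (Fin n) (Fin n) ℝ) (q : Polynomial ℂ),
      Polynomial.aeval (A.map Complex.ofReal) q ^ p = A.map Complex.ofReal ∧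
      X.map Complex.ofReal = Polynomial.aeval (A.map Complex.ofReal) q ∧
      ∀ μ ∈ spectrum ℂ (A.map Complex.ofReal), q.eval μ = g μ := by
  have hB := isUnit_det_map_ofReal hA
  obtain ⟨q, hq, hqg⟩ := exists_aeval_pow_eq hp hB g hg
  have hAc : (A.map Complex.ofReal).map (starRingEnd ℂ) = A.map Complex.ofReal := by
    ext a b
    simp
  have hqc : Polynomial.aeval (A.map Complex.ofReal) (q.map (starRingEnd ℂ)) ^ p =
      A.map Complex.ofReal := by
    rw [← map_starRingEnd_aeval]
    change (starRingEnd ℂ).mapMatrix _ ^ p = _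
    rw [← map_pow, hq]
    exact hAc
  have heq := aeval_eq_of_eval_eq hp hB hqc hq fun μ hμ => by
    have hμ' := conj_mem_spectrum_map_ofReal hμ
    have h := eval_map_starRingEnd q (starRingEnd ℂ μ)
    rw [Complex.conj_conj] at h
    rw [h, hqg _ hμ', hqg _ hμ, hgc _ hμ, Complex.conj_conj]
  refine ⟨(Polynomial.aeval (A.map Complex.ofReal) q).map Complex.re, q, hq, ?_, hqg⟩
  ext a b
  have hab := congrFun (congrFun ((map_starRingEnd_aeval A q).trans heq) a) b
  exact Complex.conj_eq_iff_re.mp hab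

theorem mem_realPrimaryRoots_iff {p : ℕ} (hp : 0 < p) (hA : IsUnit A.det)
    {X : Matrix (Fin n) (Fin n) ℝ} :
    X ∈ realPrimaryRoots p A ↔ ∃ q : Polynomial ℂ,
      Polynomial.aeval (A.map Complex.ofReal) q ^ p = A.map Complex.ofReal ∧
      X.map Complex.ofReal = Polynomial.aeval (A.map Complex.ofReal) q :=
  isPrimaryRoot_iff hp (isUnit_det_map_ofReal hA)

/-! ### Counting the admissible values -/

open Classical in
/-- The `p`-th roots of `μ` that a real matrix root may have as value at the eigenvalue `μ`: all of
them if `μ` is not real, the real ones if it is. -/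
noncomputable def admissibleRoots (p : ℕ) (μ : ℂ) : Finset ℂ :=
  (Polynomial.nthRoots p μ).toFinset.filter fun w => μ.im = 0 → w.im = 0

theorem mem_admissibleRoots {p : ℕ} (hp : 0 < p) {μ w : ℂ} :
    w ∈ admissibleRoots p μ ↔ w ^ p = μ ∧ (μ.im = 0 → w.im = 0) := by
  rw [admissibleRoots, Finset.mem_filter, Multiset.mem_toFinset, Polynomial.mem_nthRoots hp]

theorem card_admissibleRoots_of_im_ne_zero {p : ℕ} (hp : 0 < p) {μ : ℂ} (hμ : μ.im ≠ 0) :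
    (admissibleRoots p μ).card = p := by
  classical
  have hμ0 : μ ≠ 0 := by
    rintro rfl
    exact hμ rfl
  have hζ := Complex.isPrimitiveRoot_exp p hp.ne'
  rw [admissibleRoots, Finset.filter_true_of_mem (fun w _ h => absurd h hμ),
    Multiset.toFinset_card_of_nodup (hζ.nthRoots_nodup hμ0), hζ.card_nthRoots,
    if_pos ⟨_, rootBranch_pow hp 0 hμ0⟩]

theorem mem_admissibleRoots_ofReal {p : ℕ} (hp : 0 < p) {x : ℝ} {w : ℂ} :
    w ∈ admissibleRoots p x ↔ ∃ y : ℝ, y ^ p = x ∧ (y : ℂ) = w := by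
  rw [mem_admissibleRoots hp]
  constructor
  · rintro ⟨h, him⟩
    have hw : ((w.re : ℝ) : ℂ) = w := Complex.ext rfl (by simp [him (Complex.ofReal_im x)])
    refine ⟨w.re, ?_, hw⟩
    rw [← hw] at h
    exact_mod_cast h
  · rintro ⟨y, hy, rfl⟩
    exact ⟨by exact_mod_cast hy, fun _ => Complex.ofReal_im y⟩

theorem card_admissibleRoots_of_even_of_pos {p : ℕ} (hp : 0 < p) (he : Even p) {x : ℝ}
    (hx : 0 < x) : (admissibleRoots p x).card = 2 := by
  classical
  set s : ℝ := x ^ ((p : ℝ)⁻¹)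
  have hs : s ^ p = x := Real.rpow_inv_natCast_pow hx.le hp.ne'
  have hs0 : 0 < s := Real.rpow_pos_of_pos hx _
  have : admissibleRoots p x = {(s : ℂ), ((-s : ℝ) : ℂ)} := by
    ext w
    rw [mem_admissibleRoots_ofReal hp, Finset.mem_insert, Finset.mem_singleton]
    constructor
    · rintro ⟨y, hy, rfl⟩
      rw [← hs, pow_eq_pow_iff_of_ne_zero hp.ne'] at hy
      rcases hy with rfl | ⟨rfl, -⟩
      · exact Or.inl rfl
      · exact Or.inr rfl
    · rintro (rfl | rfl)
      · exact ⟨s, hs, rfl⟩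
      · exact ⟨-s, by rw [he.neg_pow, hs], rfl⟩
  rw [this, Finset.card_pair]
  intro h
  have := Complex.ofReal_injective h
  linarith

theorem card_admissibleRoots_of_even_of_neg {p : ℕ} (hp : 0 < p) (he : Even p) {x : ℝ}
    (hx : x < 0) : (admissibleRoots p x).card = 0 := by
  rw [Finset.card_eq_zero, Finset.eq_empty_iff_forall_notMem]
  intro w hw
  obtain ⟨y, hy, -⟩ := (mem_admissibleRoots_ofReal hp).mp hw
  have := he.pow_nonneg y
  linarith

theorem card_admissibleRoots_of_odd {p : ℕ} (hp : 0 < p) (ho : Odd p) (x : ℝ) :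
    (admissibleRoots p x).card = 1 := by
  obtain ⟨s, hs⟩ : ∃ s : ℝ, s ^ p = x := by
    rcases le_total 0 x with hx | hx
    · exact ⟨_, Real.rpow_inv_natCast_pow hx hp.ne'⟩
    · exact ⟨-((-x) ^ ((p : ℝ)⁻¹)), by
        rw [ho.neg_pow, Real.rpow_inv_natCast_pow (by linarith) hp.ne', neg_neg]⟩
  rw [Finset.card_eq_one]
  refine ⟨(s : ℂ), ?_⟩
  ext w
  rw [mem_admissibleRoots_ofReal hp, Finset.mem_singleton]
  constructor
  · rintro ⟨y, hy, rfl⟩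
    rw [ho.pow_injective (hy.trans hs.symm : (fun z : ℝ => z ^ p) y = (fun z : ℝ => z ^ p) s)]
  · rintro rfl
    exact ⟨s, hs, rfl⟩

/-! ### Counting the real primary roots -/

open Classical in
/-- The eigenvalues of a real matrix in the closed upper half plane: one representative of each
conjugacy class of complex eigenvalues. -/
noncomputable def upperEigenvalues (A : Matrix (Fin n) (Fin n) ℝ) : Finset ℂ :=
  (Matrix.finite_spectrum (A.map Complex.ofReal)).toFinset.filter fun μ => 0 ≤ μ.im

theorem mem_upperEigenvalues {μ : ℂ} :
    μ ∈ upperEigenvalues A ↔ μ ∈ spectrum ℂ (A.map Complex.ofReal) ∧ 0 ≤ μ.im := by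
  rw [upperEigenvalues, Finset.mem_filter, Set.Finite.mem_toFinset]

theorem exists_realPrimaryRoot_of_admissible {p : ℕ} (hp : 0 < p) (hA : IsUnit A.det) (h : ℂ → ℂ)
    (hh : ∀ μ ∈ upperEigenvalues A, h μ ∈ admissibleRoots p μ) :
    ∃ (X : Matrix (Fin n) (Fin n) ℝ) (q : Polynomial ℂ),
      Polynomial.aeval (A.map Complex.ofReal) q ^ p = A.map Complex.ofReal ∧
      X.map Complex.ofReal = Polynomial.aeval (A.map Complex.ofReal) q ∧
      ∀ μ ∈ upperEigenvalues A, q.eval μ = h μ := by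
  classical
  let g : ℂ → ℂ := fun μ => if 0 ≤ μ.im then h μ else starRingEnd ℂ (h (starRingEnd ℂ μ))
  have hh' : ∀ μ ∈ upperEigenvalues A, h μ ^ p = μ ∧ (μ.im = 0 → (h μ).im = 0) := fun μ hμ =>
    (mem_admissibleRoots hp).mp (hh μ hμ)
  obtain ⟨X, q, hq, hX, hqg⟩ := exists_real_aeval_pow_eq hp hA g (fun μ hμ => by
      simp only [g]
      split_ifs with h0
      · exact (hh' μ (mem_upperEigenvalues.mpr ⟨hμ, h0⟩)).1
      · rw [← map_pow, (hh' _ (mem_upperEigenvalues.mpr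
          ⟨conj_mem_spectrum_map_ofReal hμ, by rw [Complex.conj_im]; linarith⟩)).1,
          Complex.conj_conj])
    (fun μ hμ => by
      simp only [g, Complex.conj_im, Complex.conj_conj]
      rcases lt_trichotomy μ.im 0 with h0 | h0 | h0
      · rw [if_pos (by linarith), if_neg (by linarith), Complex.conj_conj]
      · have hc : starRingEnd ℂ μ = μ := Complex.conj_eq_iff_im.mpr h0
        have := (hh' μ (mem_upperEigenvalues.mpr ⟨hμ, h0.ge⟩)).2 h0
        rw [if_pos (by linarith), if_pos h0.ge, hc, Complex.conj_eq_iff_im.mpr this]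
      · rw [if_neg (by linarith), if_pos h0.le])
  refine ⟨X, q, hq, hX, fun μ hμ => ?_⟩
  obtain ⟨h1, h2⟩ := mem_upperEigenvalues.mp hμ
  rw [hqg μ h1]
  exact if_pos h2

theorem eval_mem_admissibleRoots {p : ℕ} (hp : 0 < p) {X : Matrix (Fin n) (Fin n) ℝ}
    {q : Polynomial ℂ}
    (hq : Polynomial.aeval (A.map Complex.ofReal) q ^ p = A.map Complex.ofReal)
    (hX : X.map Complex.ofReal = Polynomial.aeval (A.map Complex.ofReal) q)
    {μ : ℂ} (hμ : μ ∈ spectrum ℂ (A.map Complex.ofReal)) :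
    q.eval μ ∈ admissibleRoots p μ := by
  refine (mem_admissibleRoots hp).mpr ⟨eval_pow_eq_of_aeval_pow_eq hq hμ, fun h0 => ?_⟩
  have := eval_conj_of_map_ofReal_eq_aeval hX hμ
  rw [Complex.conj_eq_iff_im.mpr h0] at this
  exact Complex.conj_eq_iff_im.mp this.symm

/-- A real primary root amounts to an admissible value at each eigenvalue in the closed upper half
plane; the values in the lower half plane follow by conjugation. -/
theorem encard_realPrimaryRoots {p : ℕ} (hp : 0 < p) (hA : IsUnit A.det) :
    (realPrimaryRoots p A).encard =
      ((∏ μ ∈ upperEigenvalues A, (admissibleRoots p μ).card : ℕ) : ℕ∞) := by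
  classical
  let S : Finset (upperEigenvalues A → ℂ) :=
    Fintype.piFinset fun μ : upperEigenvalues A => admissibleRoots p μ
  have hex : ∀ h : S, ∃ (X : Matrix (Fin n) (Fin n) ℝ) (q : Polynomial ℂ),
      Polynomial.aeval (A.map Complex.ofReal) q ^ p = A.map Complex.ofReal ∧
      X.map Complex.ofReal = Polynomial.aeval (A.map Complex.ofReal) q ∧
      ∀ μ : upperEigenvalues A, q.eval (μ : ℂ) = h.1 μ := by
    rintro ⟨h, hS⟩
    obtain ⟨X, q, hq, hX, hv⟩ := exists_realPrimaryRoot_of_admissible hp hA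
      (fun μ => if hμ : μ ∈ upperEigenvalues A then h ⟨μ, hμ⟩ else 0) (fun μ hμ => by
        rw [dif_pos hμ]
        exact Fintype.mem_piFinset.mp hS ⟨μ, hμ⟩)
    exact ⟨X, q, hq, hX, fun μ => by rw [hv μ μ.2, dif_pos μ.2]⟩
  choose Φ Q hQ hΦ hv using hex
  have hinj : Function.Injective Φ := by
    intro h h' hhh
    refine Subtype.ext (funext fun μ => ?_)
    have h0 : Polynomial.aeval (A.map Complex.ofReal) (Q h - Q h') = 0 := by
      rw [map_sub, ← hΦ, ← hΦ, hhh, sub_self]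
    have := eval_eq_zero_of_aeval_eq_zero h0 (mem_upperEigenvalues.mp μ.2).1
    rw [Polynomial.eval_sub, sub_eq_zero, hv, hv] at this
    exact this
  have hrange : realPrimaryRoots p A = Φ '' Set.univ := by
    rw [Set.image_univ]
    ext X
    rw [mem_realPrimaryRoots_iff hp hA]
    constructor
    · rintro ⟨q, hq, hX⟩
      let h : S := ⟨fun μ => q.eval (μ : ℂ), Fintype.mem_piFinset.mpr fun μ =>
        eval_mem_admissibleRoots hp hq hX (mem_upperEigenvalues.mp μ.2).1⟩
      refine ⟨h, ?_⟩
      have hup : ∀ μ ∈ upperEigenvalues A, (Q h).eval μ = q.eval μ := fun μ hμ => hv h ⟨μ, hμ⟩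
      have heq := aeval_eq_of_eval_eq hp (isUnit_det_map_ofReal hA) (hQ h) hq fun μ hμ => by
        rcases le_total 0 μ.im with h0 | h0
        · exact hup μ (mem_upperEigenvalues.mpr ⟨hμ, h0⟩)
        · have hμ' := conj_mem_spectrum_map_ofReal hμ
          have h1 := hup _ (mem_upperEigenvalues.mpr
            ⟨hμ', by rw [Complex.conj_im]; linarith⟩)
          rw [eval_conj_of_map_ofReal_eq_aeval (hΦ h) hμ,
            eval_conj_of_map_ofReal_eq_aeval hX hμ] at h1
          exact (starRingEnd ℂ).injective h1
      rw [← hΦ, ← hX] at heq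
      exact Matrix.map_injective Complex.ofReal_injective heq
    · rintro ⟨h, rfl⟩
      exact ⟨Q h, hQ h, hΦ h⟩
  rw [hrange, hinj.encard_image, Set.encard_univ, ENat.card_eq_coe_fintype_card, Fintype.card_coe,
    Fintype.card_piFinset, Finset.prod_coe_sort _ fun μ => (admissibleRoots p μ).card]

theorem prod_card_admissibleRoots {p a b : ℕ} (hp : 0 < p) (hA : IsUnit A.det)
    (ha : ∀ x : ℝ, 0 < x → (admissibleRoots p x).card = a)
    (hb : ∀ x : ℝ, x < 0 → (admissibleRoots p x).card = b) :
    ∏ μ ∈ upperEigenvalues A, (admissibleRoots p μ).card =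
      p ^ numConjPairs A * (a ^ numPosEig A * b ^ numNegEig A) := by
  classical
  have hcard : ∀ μ ∈ upperEigenvalues A, (admissibleRoots p μ).card =
      if 0 < μ.im then p else if 0 < μ.re then a else b := by
    intro μ hμ
    obtain ⟨h1, h2⟩ := mem_upperEigenvalues.mp hμ
    split_ifs with h3 h4
    · exact card_admissibleRoots_of_im_ne_zero hp h3.ne'
    all_goals
      have h5 : ((μ.re : ℝ) : ℂ) = μ := Complex.ext rfl (by simp; linarith)
      rw [← h5]
    · exact ha _ h4
    · refine hb _ (lt_of_le_of_ne (not_lt.mp h4) fun h6 => ?_)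
      refine ne_zero_of_mem_spectrum (isUnit_det_map_ofReal hA) h1 ?_
      rw [← h5, h6, Complex.ofReal_zero]
  rw [Finset.prod_congr rfl hcard, Finset.prod_ite, Finset.prod_ite, Finset.prod_const,
    Finset.prod_const, Finset.prod_const]
  congr 3
  · rw [numConjPairs, ← Set.ncard_coe_finset]
    congr 1
    ext μ
    simp only [Finset.coe_filter, mem_upperEigenvalues, Set.mem_ofPred_eq]
    exact ⟨fun h => ⟨h.1.1, h.2⟩, fun h => ⟨⟨h.1, h.2.le⟩, h.2⟩⟩
  · rw [numPosEig, ← Set.ncard_coe_finset, ← Set.ncard_image_of_injective _ Complex.ofReal_injective]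
    congr 1
    ext μ
    simp only [Finset.coe_filter, Finset.mem_filter, mem_upperEigenvalues, Set.mem_ofPred_eq,
      Set.mem_image]
    constructor
    · rintro ⟨⟨⟨h1, h2⟩, h3⟩, h4⟩
      have h5 : ((μ.re : ℝ) : ℂ) = μ := Complex.ext rfl (by simp; linarith)
      exact ⟨μ.re, ⟨ofReal_mem_spectrum_map_ofReal_iff.mp (h5.symm ▸ h1), h4⟩, h5⟩
    · rintro ⟨x, ⟨h1, h2⟩, rfl⟩
      exact ⟨⟨⟨ofReal_mem_spectrum_map_ofReal_iff.mpr h1, by simp⟩, by simp⟩, by simpa using h2⟩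
  · rw [numNegEig, ← Set.ncard_coe_finset, ← Set.ncard_image_of_injective _ Complex.ofReal_injective]
    congr 1
    ext μ
    simp only [Finset.coe_filter, Finset.mem_filter, mem_upperEigenvalues, Set.mem_ofPred_eq,
      Set.mem_image]
    constructor
    · rintro ⟨⟨⟨h1, h2⟩, h3⟩, h4⟩
      have h5 : ((μ.re : ℝ) : ℂ) = μ := Complex.ext rfl (by simp; linarith)
      refine ⟨μ.re, ⟨ofReal_mem_spectrum_map_ofReal_iff.mp (h5.symm ▸ h1), ?_⟩, h5⟩
      refine lt_of_le_of_ne (not_lt.mp h4) fun h6 => ?_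
      refine ne_zero_of_mem_spectrum (isUnit_det_map_ofReal hA) h1 ?_
      rw [← h5, h6, Complex.ofReal_zero]
    · rintro ⟨x, ⟨h1, h2⟩, rfl⟩
      exact ⟨⟨⟨ofReal_mem_spectrum_map_ofReal_iff.mpr h1, by simp⟩, by simp⟩, by simpa using h2.le⟩

end RealRoots

theorem corollary2p8 (n p : ℕ) (hp : 1 < p) (A : Matrix (Fin n) (Fin n) ℝ) (hA : IsUnit A.det)
    (r₁ r₂ c : ℕ) (hr₁ : numPosEig A = r₁) (hr₂ : numNegEig A = r₂) (hc : numConjPairs A = c) :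
    (Even p →
      (r₂ = 0 → (realPrimaryRoots p A).encard = ((2 ^ r₁ * p ^ c : ℕ) : ℕ∞)) ∧
      (0 < r₂ → realPrimaryRoots p A = ∅)) ∧
    (Odd p → (realPrimaryRoots p A).encard = ((p ^ c : ℕ) : ℕ∞)) := by
  have hp0 : 0 < p := by omega
  refine ⟨fun he => ?_, fun ho => ?_⟩
  · have hcount := encard_realPrimaryRoots hp0 hA
    rw [prod_card_admissibleRoots hp0 hA
      (fun x hx => card_admissibleRoots_of_even_of_pos hp0 he hx)
      (fun x hx => card_admissibleRoots_of_even_of_neg hp0 he hx), hr₁, hr₂, hc] at hcount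
    refine ⟨fun h0 => ?_, fun h0 => ?_⟩
    · rw [hcount, h0, pow_zero, mul_one, mul_comm]
    · rwa [zero_pow h0.ne', mul_zero, mul_zero, Nat.cast_zero, Set.encard_eq_zero] at hcount
  · rw [encard_realPrimaryRoots hp0 hA, prod_card_admissibleRoots hp0 hA
      (fun x _ => card_admissibleRoots_of_odd hp0 ho x)
      (fun x _ => card_admissibleRoots_of_odd hp0 ho x), hc, one_pow, one_pow, mul_one, mul_one]
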